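/- Let $\omega=e^{2\pi i/15}$, let $N_{15}(\xi)\in\mathbb Z$ denote the norm of $\xi\in\mathbb Z[\omega]$ (for $\xi=F(\omega)$ with $F\in\mathbb Z[x]$ it equals $\prod_{1\le j\le 15,\ \gcd(j,15)=1}F(\omega^j)$), and let $\Phi_3(x)=x^2+x+1$, $\Phi_5(x)=x^4+x^3+x^2+x+1$. For $B\in\mathbb Z[x]$ consider the polynomials $$F_1(x)=(x^5-1)\pm x^{j}\Phi_3(x)B(x)+(x-1)\Phi_3(x)\Phi_5(x)g_1(x),$$ $$F_2(x)=(x^3-1)\pm x^{j'}\Phi_5(x)B(x)+(x-1)\Phi_3(x)\Phi_5(x)g_2(x),$$ with $g_1,g_2\in\mathbb Z[x]$, integers $0\le j,j'<15$ and any choice of the two signs. An element $\xi\in\mathbb Z[\omega]$ is called good if it can be written as $u_1F_1(\omega)$ or as $u_2F_2(\omega)$, with $u_1$, $u_2$ a unit of $\mathbb Z[\omega]$ and $B(x)=1$, and bad if it can be so written with $B(x)=x-1$. (a) For every $\xi\in\mathbb Z[\omega]$ with $\gcd(N_{15}(\xi),15)=1$ there is a $B(x)\in\{1,\,x-1\}$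 such that $\xi=u_1F_1(\omega)=u_2F_2(\omega)$ for some units $u_1,u_2$ of $\mathbb Z[\omega]$ and some $F_1$, $F_2$ of the above forms, both with this same $B$. (b) No $\xi\in\mathbb Z[\omega]$ with $\gcd(N_{15}(\xi),15)=1$ is both good and bad, and $1$ is bad. (c) Let $\xi_1,\xi_2\in\mathbb Z[\omega]$ have norms coprime to $15$. If both are good or both are bad, then $\xi_1\xi_2$ is bad; if one is good and the other is bad, then $\xi_1\xi_2$ is good. (d) If $\xi=F(\omega)$ with $F\in\mathbb Z[x]$ and $\gcd(N_{15}(\xi),15)=1$, then the conjugates $F(\omega^k)$, $\gcd(k,15)=1$, of $\xi$ are either all good or all bad. -/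

import Mathlib

open Polynomial

noncomputable section

namespace GoodBad

/-- The primitive 15th root of unity `exp (2πi/15)`. -/
def omega15 : ℂ := Complex.exp (2 * Real.pi * Complex.I / 15)

/-- The ring `ℤ[ω₁₅]`, as a subring of `ℂ`. -/
abbrev ZOmega : Subalgebra ℤ ℂ := Algebra.adjoin ℤ {omega15}

/-- `ω₁₅` as an element of `ℤ[ω₁₅]`. -/
def omega : ZOmega := ⟨omega15, Algebra.subset_adjoin (Set.mem_singleton omega15)⟩

theorem omega15_isPrimitiveRoot : IsPrimitiveRoot omega15 15 := by
  have h := Complex.isPrimitiveRoot_exp 15 (by norm_num)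
  simpa [omega15] using h

/-- `ℤ[ω₁₅]` is a finite free `ℤ`-module, so that `Algebra.norm ℤ` is the usual norm on it. -/
instance : Module.Finite ℤ ZOmega :=
  Algebra.finite_adjoin_simple_of_isIntegral
    (omega15_isPrimitiveRoot.isIntegral (by norm_num))

instance : Module.Free ℤ ZOmega := inferInstance

/-- The norm `N₁₅` of an element of `ℤ[ω₁₅]`, an integer. -/
def N15 (ξ : ZOmega) : ℤ := Algebra.norm ℤ ξ

/-- `F₁(x) = (x⁵ - 1) + s xʲ Φ₃(x) B(x) + (x - 1) Φ₃(x) Φ₅(x) g(x)`, with a sign `s = ±1`. -/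
def F1 (s : ℤˣ) (j : ℕ) (B g : ℤ[X]) : ℤ[X] :=
  (X ^ 5 - 1) + C (s : ℤ) * X ^ j * cyclotomic 3 ℤ * B
    + (X - 1) * cyclotomic 3 ℤ * cyclotomic 5 ℤ * g

/-- `F₂(x) = (x³ - 1) + s xʲ Φ₅(x) B(x) + (x - 1) Φ₃(x) Φ₅(x) g(x)`, with a sign `s = ±1`. -/
def F2 (s : ℤˣ) (j : ℕ) (B g : ℤ[X]) : ℤ[X] :=
  (X ^ 3 - 1) + C (s : ℤ) * X ^ j * cyclotomic 5 ℤ * B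
    + (X - 1) * cyclotomic 3 ℤ * cyclotomic 5 ℤ * g

/-- `ξ = u F₁(ω₁₅)` for a unit `u` and some choice of sign, exponent `0 ≤ j < 15` and `g`. -/
def HasFirstForm (B : ℤ[X]) (ξ : ZOmega) : Prop :=
  ∃ (u : ZOmegaˣ) (s : ℤˣ) (j : ℕ) (g : ℤ[X]), j < 15 ∧ ξ = u * aeval omega (F1 s j B g)

/-- `ξ = u F₂(ω₁₅)` for a unit `u` and some choice of sign, exponent `0 ≤ j < 15` and `g`. -/
def HasSecondForm (B : ℤ[X]) (ξ : ZOmega) : Prop :=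
  ∃ (u : ZOmegaˣ) (s : ℤˣ) (j : ℕ) (g : ℤ[X]), j < 15 ∧ ξ = u * aeval omega (F2 s j B g)

/-- `ξ` is good: it has a representation, of the first or of the second form, with `B = 1`. -/
def IsGood (ξ : ZOmega) : Prop := HasFirstForm 1 ξ ∨ HasSecondForm 1 ξ

/-- `ξ` is bad: it has a representation, of the first or of the second form, with `B = x - 1`. -/
def IsBad (ξ : ZOmega) : Prop := HasFirstForm (X - 1) ξ ∨ HasSecondForm (X - 1) ξ

end GoodBad

end

namespace GoodBad


/-! `phi5` and `phi3` generate the only primes of ℤ[ω] above 3 and 5, with residue fields of 81 and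
25 elements. Write χ₃, χ₅ for their quadratic characters (40th and 12th powers). For ξ prime to 15
put t(ξ) = χ₃(ξ)χ₅(ξ), which is `HasSign`. Good turns out to mean t = -1 and bad t = 1, and the
whole theorem then follows from multiplicativity and Galois invariance of t.

Units have t = 1 (`units_hasSign`): by Kronecker, u = (-ω)^r ū, and conjugation is a power of
Frobenius in both residue fields, so χ₃(u) = χ₅(u) = (-1)^r. Conversely, 1 - ω and 1 - ω² already
generate all pairs of residues with t = 1 (`exists_unit_of_even`), so two elements prime to 15 with
equal t agree modulo `phi3 * phi5` up to a unit. As ω - 1 is a unit, the term with g supplies every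
multiple of `phi3 * phi5`. Thus a form represents exactly the ξ with its own t, which is -χ₃(B) for
`F1` and -χ₅(B) for `F2`; both characters are 1 at B = 1 and -1 at B = x - 1. -/

/-! ### ℤ[ω] as ℤ[x]/Φ₁₅ and homomorphisms out of it -/

theorem aeval_omega_surjective : Function.Surjective (aeval (R := ℤ) omega) := by
  rintro ⟨x, hx⟩
  obtain ⟨F, hF⟩ := (Algebra.adjoin_singleton_eq_range_aeval ℤ omega15).le hx
  refine ⟨F, Subtype.ext ?_⟩
  exact (aeval_algHom_apply ZOmega.val omega F).symm.trans hF

theorem aeval_omega_eq_zero_iff (F : ℤ[X]) : aeval omega F = 0 ↔ cyclotomic 15 ℤ ∣ F := by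
  have h15 : aeval omega15 (cyclotomic 15 ℤ) = 0 := by
    rw [cyclotomic_eq_minpoly omega15_isPrimitiveRoot (by norm_num)]
    exact minpoly.aeval ℤ omega15
  rw [← Subtype.coe_inj, show ((aeval omega F : ZOmega) : ℂ) = aeval omega15 F from
    (aeval_algHom_apply ZOmega.val omega F).symm]
  change aeval omega15 F = 0 ↔ _
  constructor
  · intro h
    rw [cyclotomic_eq_minpoly omega15_isPrimitiveRoot (by norm_num)]
    exact minpoly.isIntegrallyClosed_dvd
      (omega15_isPrimitiveRoot.isIntegral (by norm_num)) h
  · rintro ⟨G, rfl⟩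
    rw [map_mul, h15, zero_mul]

/-- The ring homomorphism `ℤ[ω] → C` that sends `ω` to a root `c` of `Φ₁₅`. -/
noncomputable def lift {C : Type*} [CommRing C] (c : C) (hc : aeval c (cyclotomic 15 ℤ) = 0) :
    ZOmega →+* C :=
  (aeval (R := ℤ) omega).toRingHom.liftOfSurjective aeval_omega_surjective
    ⟨(aeval (R := ℤ) c).toRingHom, by
      intro F hF
      obtain ⟨G, rfl⟩ := (aeval_omega_eq_zero_iff F).1 hF
      change aeval c (cyclotomic 15 ℤ * G) = 0
      rw [map_mul, hc, zero_mul]⟩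

theorem lift_aeval {C : Type*} [CommRing C] (c : C) (hc : aeval c (cyclotomic 15 ℤ) = 0)
    (F : ℤ[X]) : lift c hc (aeval omega F) = aeval c F :=
  RingHom.liftOfSurjective_comp_apply (aeval (R := ℤ) omega).toRingHom aeval_omega_surjective _ F

theorem lift_omega {C : Type*} [CommRing C] (c : C) (hc : aeval c (cyclotomic 15 ℤ) = 0) :
    lift c hc omega = c := by
  simpa using lift_aeval c hc X

theorem ringHom_ext {C : Type*} [CommRing C] {f g : ZOmega →+* C} (h : f omega = g omega) :
    f = g := by
  ext x
  obtain ⟨F, rfl⟩ := aeval_omega_surjective x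
  change f.toIntAlgHom _ = g.toIntAlgHom _
  rw [← aeval_algHom_apply, ← aeval_algHom_apply]
  exact congrArg (fun c => aeval c F) h

theorem omega_isPrimitiveRoot : IsPrimitiveRoot omega 15 :=
  IsPrimitiveRoot.of_map_of_injective (f := ZOmega.val) omega15_isPrimitiveRoot
    Subtype.val_injective

theorem aeval_cyclotomic_of_isPrimitiveRoot {C : Type*} [CommRing C] [IsDomain C] {c : C}
    (hc : IsPrimitiveRoot c 15) : aeval c (cyclotomic 15 ℤ) = 0 := by
  have := hc.isRoot_cyclotomic (by norm_num)
  rwa [aeval_def, ← eval_map, map_cyclotomic]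

theorem cyclotomic_five_int : cyclotomic 5 ℤ = X ^ 4 + X ^ 3 + X ^ 2 + X + 1 := by
  have : Fact (Nat.Prime 5) := ⟨by norm_num⟩
  rw [cyclotomic_prime]
  simp only [Finset.sum_range_succ, Finset.sum_range_zero]
  ring

/-! ### Explicit units and the elements above 3 and 5 -/

theorem omega_pow_fifteen : omega ^ 15 = 1 := omega_isPrimitiveRoot.pow_eq_one

theorem omega_relation :
    omega ^ 8 - omega ^ 7 + omega ^ 5 - omega ^ 4 + omega ^ 3 - omega + 1 = 0 := by
  have h3 : omega ^ 3 - 1 ≠ 0 :=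
    sub_ne_zero.2 (omega_isPrimitiveRoot.pow_ne_one_of_pos_of_lt (by norm_num) (by norm_num))
  have h5 : omega ^ 5 - 1 ≠ 0 :=
    sub_ne_zero.2 (omega_isPrimitiveRoot.pow_ne_one_of_pos_of_lt (by norm_num) (by norm_num))
  -- (x³ - 1)(x⁵ - 1)Φ₁₅(x) = (x - 1)(x¹⁵ - 1).
  have h : (omega ^ 3 - 1) * (omega ^ 5 - 1) *
      (omega ^ 8 - omega ^ 7 + omega ^ 5 - omega ^ 4 + omega ^ 3 - omega + 1) = 0 := by
    linear_combination (omega - 1) * omega_pow_fifteen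
  exact (mul_eq_zero.1 h).resolve_left (mul_ne_zero h3 h5)

/-- The unit `1 - ω`. -/
noncomputable def unitOneSub : ZOmegaˣ :=
  Units.mkOfMulEqOne (1 - omega) (omega ^ 7 + omega ^ 4 + omega ^ 2 + omega)
    (by linear_combination -omega_relation)

/-- The unit `1 + ω`. -/
noncomputable def unitOneAdd : ZOmegaˣ :=
  Units.mkOfMulEqOne (1 + omega)
    (-omega ^ 7 + 2 * omega ^ 6 - 2 * omega ^ 5 + omega ^ 4 - omega ^ 2 + omega)
    (by linear_combination -omega_relation)

theorem coe_unitOneSub : (unitOneSub : ZOmega) = 1 - omega := rfl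

/-- `Φ₅(ω)`, a generator of the prime above `3`. -/
noncomputable def phi5 : ZOmega := omega ^ 4 + omega ^ 3 + omega ^ 2 + omega + 1

/-- `Φ₃(ω)`, a generator of the prime above `5`. -/
noncomputable def phi3 : ZOmega := omega ^ 2 + omega + 1

theorem phi5_eq : aeval omega (cyclotomic 5 ℤ) = phi5 := by
  simp [cyclotomic_five_int, phi5]

theorem phi3_eq : aeval omega (cyclotomic 3 ℤ) = phi3 := by
  simp [phi3]

/-- (1 - ω)Φ₅(ω) = 1 - ω⁵, and η = ω⁵ is a cube root of unity with (1 - η)² = -3η. -/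
theorem three_dvd_phi5_sq : (3 : ZOmega) ∣ phi5 ^ 2 := by
  have h : (unitOneSub : ZOmega) ^ 2 * phi5 ^ 2 = 3 * (-omega ^ 5) := by
    rw [coe_unitOneSub, phi5]
    linear_combination (omega ^ 2 + omega + 1) * omega_relation
  have h2 : (3 : ZOmega) ∣ (unitOneSub ^ 2 : ZOmegaˣ) * phi5 ^ 2 := by
    rw [Units.val_pow_eq_pow_val, h]
    exact dvd_mul_right _ _
  exact (Units.dvd_mul_left).1 h2

theorem phi5_dvd_three : phi5 ∣ 3 := by
  refine ⟨-omega ^ 10 * (1 - omega) ^ 2 * phi5, ?_⟩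
  have h : (1 - omega) ^ 2 * phi5 ^ 2 = 3 * (-omega ^ 5) := by
    rw [phi5]
    linear_combination (omega ^ 2 + omega + 1) * omega_relation
  linear_combination omega ^ 10 * h - 3 * omega_pow_fifteen

theorem omega_pow_twelve :
    omega ^ 12 + omega ^ 9 + omega ^ 6 + omega ^ 3 + 1 = 0 := by
  linear_combination (omega ^ 4 + omega ^ 3 + omega ^ 2 + omega + 1) * omega_relation

/-- The left side is (1 - η)⁴ for the fifth root of unity η = ω³; subtracting 1 + η + η² + η³ + η⁴ =
0 leaves a multiple of 5. -/
theorem phi3_pow_four : (1 - omega) ^ 4 * phi3 ^ 4 =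
    5 * (-omega ^ 9 + omega ^ 6 - omega ^ 3) := by
  rw [phi3]
  linear_combination omega_pow_twelve

theorem five_dvd_phi3_pow : (5 : ZOmega) ∣ phi3 ^ 4 := by
  have h2 : (5 : ZOmega) ∣ (unitOneSub ^ 4 : ZOmegaˣ) * phi3 ^ 4 := by
    rw [Units.val_pow_eq_pow_val, coe_unitOneSub, phi3_pow_four]
    exact dvd_mul_right _ _
  exact (Units.dvd_mul_left).1 h2

theorem phi3_dvd_five : phi3 ∣ 5 := by
  have h : phi3 ∣ (omega ^ 3 - 1) := ⟨omega - 1, by rw [phi3]; ring⟩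
  have h2 : (5 : ZOmega) = (omega ^ 3 - 1) *
      -(omega ^ 9 + 2 * omega ^ 6 + 3 * omega ^ 3 + 4) := by
    linear_combination omega_pow_twelve
  rw [h2]
  exact h.mul_right _

theorem isCoprime_phi3_phi5 : IsCoprime phi3 phi5 := by
  obtain ⟨a, ha⟩ := phi3_dvd_five
  obtain ⟨b, hb⟩ := phi5_dvd_three
  -- 2·3 - 5 = 1.
  exact ⟨-a, 2 * b, by linear_combination 2 * (-hb) + ha⟩

theorem prime_dvd_N15 {p : ℕ} (hp : p.Prime) {x ξ : ZOmega} {k : ℕ}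
    (hx : (p : ZOmega) ∣ x ^ k) (h : x ∣ ξ) : (p : ℤ) ∣ N15 ξ := by
  have hp' : Prime (p : ℤ) := Nat.prime_iff_prime_int.1 hp
  have h1 : N15 (p : ZOmega) = (p : ℤ) ^ Module.finrank ℤ ZOmega := by
    have := Algebra.norm_algebraMap (R := ℤ) (S := ZOmega) (p : ℤ)
    simpa [N15] using this
  have h2 : (p : ℤ) ∣ N15 (p : ZOmega) := by
    rw [h1]
    exact dvd_pow_self _ Module.finrank_pos.ne'
  have h3 : N15 (p : ZOmega) ∣ N15 x ^ k := by
    have := map_dvd (Algebra.norm ℤ) hx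
    rwa [map_pow] at this
  exact (hp'.dvd_of_dvd_pow (h2.trans h3)).trans (map_dvd (Algebra.norm ℤ) h)

theorem not_phi5_dvd {ξ : ZOmega} (h : Int.gcd (N15 ξ) 15 = 1) : ¬ phi5 ∣ ξ := by
  intro hd
  have h3 : (3 : ℤ) ∣ N15 ξ :=
    prime_dvd_N15 (p := 3) (by norm_num) (by exact_mod_cast three_dvd_phi5_sq) hd
  have := Int.dvd_coe_gcd h3 (by norm_num : (3 : ℤ) ∣ 15)
  rw [h] at this
  norm_num at this

theorem not_phi3_dvd {ξ : ZOmega} (h : Int.gcd (N15 ξ) 15 = 1) : ¬ phi3 ∣ ξ := by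
  intro hd
  have h5 : (5 : ℤ) ∣ N15 ξ :=
    prime_dvd_N15 (p := 5) (by norm_num) (by exact_mod_cast five_dvd_phi3_pow) hd
  have := Int.dvd_coe_gcd h5 (by norm_num : (5 : ℤ) ∣ 15)
  rw [h] at this
  norm_num at this


/-! ### Finite rings exhausted by zero and the powers of one unit -/

theorem card_le_of_aeval_surjective {A : Type*} [CommRing A] (p : ℕ) [NeZero p] [CharP A p]
    {w : A} (hw : Function.Surjective (aeval (R := ℤ) w)) {f : ℤ[X]} (hf : f.Monic)
    (h0 : aeval w f = 0) : Finite A ∧ Nat.card A ≤ p ^ f.natDegree := by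
  have hs : Function.Surjective
      (fun c : Fin f.natDegree → ZMod p => ∑ i, ZMod.castHom dvd_rfl A (c i) * w ^ (i : ℕ)) := by
    intro a
    obtain ⟨F, rfl⟩ := hw a
    refine ⟨fun i => (((F %ₘ f).coeff i : ℤ) : ZMod p), ?_⟩
    have h1 : aeval w F = aeval w (F %ₘ f) := by
      conv_lhs => rw [← modByMonic_add_div F f]
      rw [map_add, map_mul, h0, zero_mul, add_zero]
    rw [h1]
    by_cases hd : f.natDegree = 0
    · have hf1 : f = 1 := eq_one_of_monic_natDegree_zero hf hd
      subst hf1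
      simp
    · rw [aeval_eq_sum_range' (n := f.natDegree)
        (natDegree_modByMonic_lt F hf (by rintro rfl; simp at hd))]
      rw [← Fin.sum_univ_eq_sum_range (fun i => (F %ₘ f).coeff i • w ^ i)]
      refine Finset.sum_congr rfl fun i _ => ?_
      rw [map_intCast, zsmul_eq_mul]
  refine ⟨Finite.of_surjective _ hs, ?_⟩
  have := Nat.card_le_card_of_surjective _ hs
  simpa using this

/-- Zero and the m powers of g already number m + 1. An upper bound on the cardinality therefore
suffices, and A need not be known to be a field. -/
theorem exists_pow_eq_of_orderOf {A : Type*} [CommRing A] [Nontrivial A] [Finite A] {m : ℕ}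
    (hA : Nat.card A ≤ m + 1) (g : Aˣ) (hg : orderOf g = m) {a : A} (ha : a ≠ 0) :
    ∃ k : ℕ, a = (g : A) ^ k := by
  have hinj : Set.InjOn (fun k : ℕ => (g : A) ^ k) (Finset.range m) := by
    intro i hi j hj hij
    simp only [Finset.coe_range, Set.mem_Iio] at hi hj
    refine pow_injOn_Iio_orderOf (x := g) (by simpa [hg]) (by simpa [hg]) ?_
    exact Units.ext (by simpa using hij)
  classical
  have := Fintype.ofFinite A
  let S : Finset A := (Finset.range m).image (fun k => (g : A) ^ k)
  have hS : S.card = m := by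
    rw [Finset.card_image_of_injOn hinj, Finset.card_range]
  have h0 : (0 : A) ∉ S := by
    simp only [S, Finset.mem_image, not_exists, not_and]
    intro k _ hk
    exact (g ^ k).ne_zero (by simpa using hk)
  have hu : insert 0 S = Finset.univ := by
    apply Finset.eq_univ_of_card
    apply le_antisymm (Finset.card_le_univ _)
    rw [Finset.card_insert_of_notMem h0, hS, ← Nat.card_eq_fintype_card]
    exact hA
  have hmem : a ∈ insert 0 S := hu ▸ Finset.mem_univ a
  obtain h | h := Finset.mem_insert.1 hmem
  · exact absurd h ha
  · obtain ⟨k, _, hk⟩ := Finset.mem_image.1 h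
    exact ⟨k, hk.symm⟩


/-! ### The residue fields, with conjugation acting as a power of Frobenius -/

/-- The residue field at the prime above `3`; it has 81 elements. -/
abbrev F81 := ZOmega ⧸ Ideal.span {phi5}

/-- The residue field at the prime above `5`; it has 25 elements. -/
abbrev F25 := ZOmega ⧸ Ideal.span {phi3}

/-- Reduction modulo the prime above `3`. -/
noncomputable abbrev r3 : ZOmega →+* F81 := Ideal.Quotient.mk _

/-- Reduction modulo the prime above `5`. -/
noncomputable abbrev r5 : ZOmega →+* F25 := Ideal.Quotient.mk _

theorem r3_eq_zero_iff {x : ZOmega} : r3 x = 0 ↔ phi5 ∣ x := Ideal.Quotient.eq_zero_iff_dvd _ _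

theorem r5_eq_zero_iff {x : ZOmega} : r5 x = 0 ↔ phi3 ∣ x := Ideal.Quotient.eq_zero_iff_dvd _ _

theorem gcd_N15_one : Int.gcd (N15 1) 15 = 1 := by
  simp [N15]

instance : Nontrivial F81 :=
  ⟨⟨r3 1, 0, fun h => not_phi5_dvd gcd_N15_one (r3_eq_zero_iff.1 h)⟩⟩

instance : Nontrivial F25 :=
  ⟨⟨r5 1, 0, fun h => not_phi3_dvd gcd_N15_one (r5_eq_zero_iff.1 h)⟩⟩

theorem three_eq_zero : (3 : F81) = 0 := by
  exact (map_ofNat r3 3).symm.trans (r3_eq_zero_iff.2 phi5_dvd_three)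

theorem five_eq_zero : (5 : F25) = 0 := by
  exact (map_ofNat r5 5).symm.trans (r5_eq_zero_iff.2 phi3_dvd_five)

instance : CharP F81 3 :=
  (CharP.charP_iff_prime_eq_zero (by norm_num)).2 (by exact_mod_cast three_eq_zero)

instance : CharP F25 5 :=
  (CharP.charP_iff_prime_eq_zero (by norm_num)).2 (by exact_mod_cast five_eq_zero)

instance : Fact (Nat.Prime 3) := ⟨by norm_num⟩

instance : Fact (Nat.Prime 5) := ⟨by norm_num⟩

theorem r3_phi5 : r3 omega ^ 4 + r3 omega ^ 3 + r3 omega ^ 2 + r3 omega + 1 = 0 := by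
  have := r3_eq_zero_iff.2 (dvd_refl phi5)
  simpa only [phi5, map_add, map_pow, map_one] using this

theorem r5_phi3 : r5 omega ^ 2 + r5 omega + 1 = 0 := by
  have := r5_eq_zero_iff.2 (dvd_refl phi3)
  simpa only [phi3, map_add, map_pow, map_one] using this

theorem r3_omega_pow : r3 omega ^ 5 = 1 := by
  linear_combination (r3 omega - 1) * r3_phi5

theorem r5_omega_pow : r5 omega ^ 3 = 1 := by
  linear_combination (r5 omega - 1) * r5_phi3

theorem one_ne_neg_one_F81 : (1 : F81) ≠ -1 := by
  intro h
  exact one_ne_zero (by linear_combination three_eq_zero - h : (1 : F81) = 0)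

theorem one_ne_neg_one_F25 : (1 : F25) ≠ -1 := by
  intro h
  exact one_ne_zero (by linear_combination five_eq_zero - 2 * h : (1 : F25) = 0)

/-- Complex conjugation on `ℤ[ω]`. -/
noncomputable def conj : ZOmega →+* ZOmega :=
  lift (omega ^ 14) (aeval_cyclotomic_of_isPrimitiveRoot
    (omega_isPrimitiveRoot.pow_of_coprime 14 (by norm_num)))

theorem conj_omega : conj omega = omega ^ 14 := lift_omega _ _

theorem r3_conj (x : ZOmega) : r3 (conj x) = r3 x ^ 9 := by
  -- Both maps are determined by ω, and ω¹⁴ = ω⁹ because ω⁵ = 1 here.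
  have : r3.comp conj = (iterateFrobenius F81 3 2).comp r3 := by
    apply ringHom_ext
    simp only [RingHom.comp_apply, conj_omega, iterateFrobenius_def, map_pow]
    linear_combination (r3 omega ^ 9) * r3_omega_pow
  exact congrArg (fun f => f x) this

theorem r5_conj (x : ZOmega) : r5 (conj x) = r5 x ^ 5 := by
  -- Here ω³ = 1, so ω¹⁴ = ω⁵.
  have : r5.comp conj = (iterateFrobenius F25 5 1).comp r5 := by
    apply ringHom_ext
    simp only [RingHom.comp_apply, conj_omega, iterateFrobenius_def, map_pow]
    linear_combination (r5 omega ^ 5 + r5 omega ^ 8 + r5 omega ^ 11) * r5_omega_pow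
  exact congrArg (fun f => f x) this

theorem neg_one_pow_sq {A : Type*} [CommRing A] (r : ℕ) : ((-1 : A) ^ r) ^ 2 = 1 := by
  rw [← pow_mul, mul_comm, pow_mul, neg_one_sq, one_pow]

theorem r3_pow_eight (u : ZOmegaˣ) {r : ℕ} (h : (u : ZOmega) = (-omega) ^ r * conj u) :
    (-r3 omega) ^ r * r3 u ^ 8 = 1 := by
  have h1 := congrArg r3 h
  rw [map_mul, r3_conj, map_pow, map_neg] at h1
  apply ((u.isUnit.map r3).mul_left_inj).1
  linear_combination -h1

theorem r5_pow_four (u : ZOmegaˣ) {r : ℕ} (h : (u : ZOmega) = (-omega) ^ r * conj u) :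
    (-r5 omega) ^ r * r5 u ^ 4 = 1 := by
  have h1 := congrArg r5 h
  rw [map_mul, r5_conj, map_pow, map_neg] at h1
  apply ((u.isUnit.map r5).mul_left_inj).1
  linear_combination -h1

theorem r3_pow_forty (u : ZOmegaˣ) {r : ℕ} (h : (u : ZOmega) = (-omega) ^ r * conj u) :
    r3 u ^ 40 = (-1) ^ r := by
  have h1 : ((-r3 omega) ^ r * r3 u ^ 8) ^ 5 = 1 := by rw [r3_pow_eight u h, one_pow]
  have h2 : ((-r3 omega) ^ r) ^ 5 = (-1) ^ r := by
    rw [← pow_mul, mul_comm, pow_mul]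
    congr 1
    linear_combination -r3_omega_pow
  have h3 : ((-1 : F81) ^ r) ^ 2 = 1 := neg_one_pow_sq r
  rw [mul_pow, h2] at h1
  linear_combination (-1) ^ r * h1 - r3 u ^ 40 * h3

theorem r5_pow_twelve (u : ZOmegaˣ) {r : ℕ} (h : (u : ZOmega) = (-omega) ^ r * conj u) :
    r5 u ^ 12 = (-1) ^ r := by
  have h1 : ((-r5 omega) ^ r * r5 u ^ 4) ^ 3 = 1 := by rw [r5_pow_four u h, one_pow]
  have h2 : ((-r5 omega) ^ r) ^ 3 = (-1) ^ r := by
    rw [← pow_mul, mul_comm, pow_mul]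
    congr 1
    linear_combination -r5_omega_pow
  have h3 : ((-1 : F25) ^ r) ^ 2 = 1 := neg_one_pow_sq r
  rw [mul_pow, h2] at h1
  linear_combination (-1) ^ r * h1 - r5 u ^ 12 * h3

theorem unitOneSub_eq : (unitOneSub : ZOmega) = (-omega) ^ 1 * conj unitOneSub := by
  rw [coe_unitOneSub, map_sub, map_one, conj_omega]
  linear_combination -omega_pow_fifteen

/-! ### 1 - ω generates both residue groups -/

/-- A generator of the multiplicative group of the residue field at `3`. -/
noncomputable def g3 : F81ˣ := Units.map r3 unitOneSub

/-- A generator of the multiplicative group of the residue field at `5`. -/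
noncomputable def g5 : F25ˣ := Units.map r5 unitOneSub

theorem coe_g3 : (g3 : F81) = r3 unitOneSub := rfl

theorem coe_g5 : (g5 : F25) = r5 unitOneSub := rfl

theorem g3_pow : (g3 : F81) ^ 40 = -1 := by
  rw [coe_g3, r3_pow_forty _ unitOneSub_eq, pow_one]

theorem g5_pow : (g5 : F25) ^ 12 = -1 := by
  rw [coe_g5, r5_pow_twelve _ unitOneSub_eq, pow_one]

/-- The exponent 40 gives -1. If the 16th power were 1, squaring -ω(1 - ω)⁸ = 1 would give ω² = 1,
hence ω = 1 and Φ₅(1) = 5 = 0 in characteristic 3. -/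
theorem orderOf_g3 : orderOf g3 = 80 := by
  have h8 := r3_pow_eight _ unitOneSub_eq
  rw [← coe_g3, pow_one] at h8
  apply orderOf_eq_of_pow_and_pow_div_prime (by norm_num)
  · apply Units.ext
    rw [Units.val_pow_eq_pow_val, Units.val_one]
    linear_combination ((g3 : F81) ^ 40 - 1) * g3_pow
  · intro p hp hd h
    have h' := congrArg Units.val h
    rw [Units.val_pow_eq_pow_val, Units.val_one] at h'
    have : p ∣ 2 ^ 4 * 5 := by simpa using hd
    obtain h2 | h5 := (Nat.Prime.dvd_mul hp).1 this
    · obtain rfl := (Nat.prime_dvd_prime_iff_eq hp Nat.prime_two).1 (hp.dvd_of_dvd_pow h2)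
      replace h' : (g3 : F81) ^ 40 = 1 := h'
      rw [g3_pow] at h'
      exact one_ne_neg_one_F81 h'.symm
    · obtain rfl := (Nat.prime_dvd_prime_iff_eq hp Nat.prime_five).1 h5
      replace h' : (g3 : F81) ^ 16 = 1 := h'
      have hw2 : r3 omega ^ 2 = 1 := by
        linear_combination (-r3 omega * (g3 : F81) ^ 8 + 1) * h8 - r3 omega ^ 2 * h'
      have hw : r3 omega = 1 := by
        linear_combination r3_omega_pow - (r3 omega ^ 3 + r3 omega) * hw2
      have h5 := r3_phi5
      rw [hw] at h5
      exact one_ne_zero (by linear_combination 2 * three_eq_zero - h5 : (1 : F81) = 0)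

theorem orderOf_g5 : orderOf g5 = 24 := by
  have h4 := r5_pow_four _ unitOneSub_eq
  rw [← coe_g5, pow_one] at h4
  apply orderOf_eq_of_pow_and_pow_div_prime (by norm_num)
  · apply Units.ext
    rw [Units.val_pow_eq_pow_val, Units.val_one]
    linear_combination ((g5 : F25) ^ 12 - 1) * g5_pow
  · intro p hp hd h
    have h' := congrArg Units.val h
    rw [Units.val_pow_eq_pow_val, Units.val_one] at h'
    have : p ∣ 2 ^ 3 * 3 := by simpa using hd
    obtain h2 | h3 := (Nat.Prime.dvd_mul hp).1 this
    · obtain rfl := (Nat.prime_dvd_prime_iff_eq hp Nat.prime_two).1 (hp.dvd_of_dvd_pow h2)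
      replace h' : (g5 : F25) ^ 12 = 1 := h'
      rw [g5_pow] at h'
      exact one_ne_neg_one_F25 h'.symm
    · obtain rfl := (Nat.prime_dvd_prime_iff_eq hp Nat.prime_three).1 h3
      replace h' : (g5 : F25) ^ 8 = 1 := h'
      have hw2 : r5 omega ^ 2 = 1 := by
        linear_combination (-r5 omega * (g5 : F25) ^ 4 + 1) * h4 - r5 omega ^ 2 * h'
      have hw : r5 omega = 1 := by
        linear_combination r5_omega_pow - r5 omega * hw2
      have h5 := r5_phi3
      rw [hw] at h5
      exact one_ne_zero (by linear_combination 2 * h5 - five_eq_zero : (1 : F25) = 0)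

theorem aeval_r3_surjective : Function.Surjective (aeval (R := ℤ) (r3 omega)) := by
  intro a
  obtain ⟨x, rfl⟩ := Ideal.Quotient.mk_surjective a
  obtain ⟨F, rfl⟩ := aeval_omega_surjective x
  exact ⟨F, aeval_algHom_apply r3.toIntAlgHom omega F⟩

theorem aeval_r5_surjective : Function.Surjective (aeval (R := ℤ) (r5 omega)) := by
  intro a
  obtain ⟨x, rfl⟩ := Ideal.Quotient.mk_surjective a
  obtain ⟨F, rfl⟩ := aeval_omega_surjective x
  exact ⟨F, aeval_algHom_apply r5.toIntAlgHom omega F⟩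

theorem exists_r3_eq_pow {x : ZOmega} (hx : ¬ phi5 ∣ x) : ∃ k : ℕ, r3 x = (g3 : F81) ^ k := by
  obtain ⟨hfin, hcard⟩ := card_le_of_aeval_surjective 3 aeval_r3_surjective
    (cyclotomic.monic 5 ℤ) (by simpa [cyclotomic_five_int] using r3_phi5)
  rw [natDegree_cyclotomic, show Nat.totient 5 = 4 from rfl] at hcard
  exact exists_pow_eq_of_orderOf hcard g3 orderOf_g3 (mt r3_eq_zero_iff.1 hx)

theorem exists_r5_eq_pow {x : ZOmega} (hx : ¬ phi3 ∣ x) : ∃ k : ℕ, r5 x = (g5 : F25) ^ k := by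
  obtain ⟨hfin, hcard⟩ := card_le_of_aeval_surjective 5 aeval_r5_surjective
    (cyclotomic.monic 3 ℤ) (by simpa using r5_phi3)
  rw [natDegree_cyclotomic, show Nat.totient 3 = 2 from rfl] at hcard
  exact exists_pow_eq_of_orderOf hcard g5 orderOf_g5 (mt r5_eq_zero_iff.1 hx)


/-! ### Kronecker's theorem: u/ū is a power of -ω -/

theorem exists_eq_neg_omega_pow_mul_conj_aux (K : Type*) [Field K] [NumberField K]
    [IsCyclotomicExtension {15} ℚ K] (u : ZOmegaˣ) :
    ∃ r : ℕ, (u : ZOmega) = (-omega) ^ r * conj u := by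
  let ζ : K := IsCyclotomicExtension.zeta 15 ℚ K
  have hζ : IsPrimitiveRoot ζ 15 := IsCyclotomicExtension.zeta_spec 15 ℚ K
  let θ : ZOmega →+* K := lift ζ (aeval_cyclotomic_of_isPrimitiveRoot hζ)
  have hθω : θ omega = ζ := lift_omega _ _
  have hθ : Function.Injective θ := by
    rw [injective_iff_map_eq_zero]
    intro x hx
    obtain ⟨F, rfl⟩ := aeval_omega_surjective x
    rw [aeval_omega_eq_zero_iff, cyclotomic_eq_minpoly hζ (by norm_num)]
    refine minpoly.isIntegrallyClosed_dvd (hζ.isIntegral (by norm_num)) ?_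
    rwa [← lift_aeval ζ (aeval_cyclotomic_of_isPrimitiveRoot hζ)]
  have hint : ∀ x : ZOmega, IsIntegral ℤ (θ x) := fun x =>
    (Algebra.IsIntegral.isIntegral (R := ℤ) x).map θ.toIntAlgHom
  -- Each complex embedding sends ζ to the unit circle, where the 14th power of a 15th root of unity
  -- is its complex conjugate.
  have hconj : ∀ (φ : K →+* ℂ) (x : ZOmega), φ (θ (conj x)) = starRingEnd ℂ (φ (θ x)) := by
    intro φ x
    have : (φ.comp θ).comp conj = (starRingEnd ℂ).comp (φ.comp θ) := by
      apply ringHom_ext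
      have h15 : φ ζ ^ 15 = 1 := by rw [← map_pow, hζ.pow_eq_one, map_one]
      have hn : ‖φ ζ‖ = 1 := Complex.norm_eq_one_of_pow_eq_one h15 (by norm_num)
      simp only [RingHom.comp_apply, conj_omega, map_pow, hθω]
      have h1 : φ ζ * starRingEnd ℂ (φ ζ) = 1 := by
        rw [Complex.mul_conj, Complex.normSq_eq_norm_sq, hn]
        norm_num
      linear_combination starRingEnd ℂ (φ ζ) * h15 - φ ζ ^ 14 * h1
    exact congrArg (fun f => f x) this
  let v : ZOmegaˣ := u * (Units.map (conj : ZOmega →* ZOmega) u)⁻¹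
  have hv : (v : ZOmega) * conj u = u := by
    have : v * Units.map (conj : ZOmega →* ZOmega) u = u := by simp [v]
    exact congrArg Units.val this
  obtain ⟨n, hn, hpow⟩ := NumberField.Embeddings.pow_eq_one_of_norm_eq_one K ℂ (hint v) (by
    intro φ
    have h1 : φ (θ v) * φ (θ (conj u)) = φ (θ u) := by rw [← map_mul, ← map_mul, hv]
    rw [hconj] at h1
    have h2 := congrArg norm h1
    rw [norm_mul, RCLike.norm_conj] at h2
    have h3 : ‖φ (θ u)‖ ≠ 0 := norm_ne_zero_iff.2 ((u.isUnit.map θ).map φ).ne_zero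
    exact mul_right_cancel₀ h3 (h2.trans (one_mul _).symm))
  -- Since 15 is odd, the roots of unity of the field, ±ζⁱ, are all powers of -ζ.
  obtain ⟨r, hr⟩ := IsPrimitiveRoot.exists_neg_pow_of_isOfFinOrder (n := 15) (by decide) hζ
    (isOfFinOrder_iff_pow_eq_one.2 ⟨n, hn, hpow⟩)
  refine ⟨r, ?_⟩
  have hvr : (v : ZOmega) = (-omega) ^ r := hθ (by rw [hr, map_pow, map_neg, hθω])
  rw [← hvr, hv]

theorem exists_eq_neg_omega_pow_mul_conj (u : ZOmegaˣ) :
    ∃ r : ℕ, (u : ZOmega) = (-omega) ^ r * conj u :=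
  have : IsCyclotomicExtension {15} ℚ (CyclotomicField 15 ℚ) :=
    CyclotomicField.isCyclotomicExtension 15 ℚ
  exists_eq_neg_omega_pow_mul_conj_aux (CyclotomicField 15 ℚ) u


/-! ### The sign t and its values on units -/

/-- `t` is the product of the quadratic characters of `ξ` at the primes above `3` and `5`. -/
def HasSign (ξ : ZOmega) (t : ℤˣ) : Prop :=
  ∃ s₃ s₅ : ℤˣ, s₃ * s₅ = t ∧ r3 ξ ^ 40 = ((s₃ : ℤ) : F81) ∧ r5 ξ ^ 12 = ((s₅ : ℤ) : F25)

theorem units_cast_injective {A : Type*} [CommRing A] (hA : (1 : A) ≠ -1) {s t : ℤˣ}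
    (h : ((s : ℤ) : A) = ((t : ℤ) : A)) : s = t := by
  obtain rfl | rfl := Int.units_eq_one_or s <;> obtain rfl | rfl := Int.units_eq_one_or t
  · rfl
  · exact absurd (by simpa using h) hA
  · exact absurd (by simpa using h.symm) hA
  · rfl

theorem HasSign.unique {ξ : ZOmega} {t t' : ℤˣ} (h : HasSign ξ t) (h' : HasSign ξ t') :
    t = t' := by
  obtain ⟨a, b, rfl, ha, hb⟩ := h
  obtain ⟨a', b', rfl, ha', hb'⟩ := h'
  rw [units_cast_injective one_ne_neg_one_F81 (ha.symm.trans ha'),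
    units_cast_injective one_ne_neg_one_F25 (hb.symm.trans hb')]

theorem HasSign.mul {ξ η : ZOmega} {t t' : ℤˣ} (h : HasSign ξ t) (h' : HasSign η t') :
    HasSign (ξ * η) (t * t') := by
  obtain ⟨a, b, rfl, ha, hb⟩ := h
  obtain ⟨a', b', rfl, ha', hb'⟩ := h'
  refine ⟨a * a', b * b', mul_mul_mul_comm _ _ _ _, ?_, ?_⟩
  · rw [map_mul, mul_pow, ha, ha', Units.val_mul, Int.cast_mul]
  · rw [map_mul, mul_pow, hb, hb', Units.val_mul, Int.cast_mul]

theorem units_hasSign (u : ZOmegaˣ) : HasSign u 1 := by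
  obtain ⟨r, hr⟩ := exists_eq_neg_omega_pow_mul_conj u
  refine ⟨(-1) ^ r, (-1) ^ r, ?_, ?_, ?_⟩
  · rw [← mul_pow]
    simp
  · rw [r3_pow_forty u hr]
    simp
  · rw [r5_pow_twelve u hr]
    simp

theorem hasSign_of_eq_pow {ξ : ZOmega} {a b : ℕ} (ha : r3 ξ = (g3 : F81) ^ a)
    (hb : r5 ξ = (g5 : F25) ^ b) : HasSign ξ ((-1) ^ (a + b)) := by
  refine ⟨(-1) ^ a, (-1) ^ b, (pow_add _ _ _).symm, ?_, ?_⟩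
  · rw [ha, pow_right_comm, g3_pow]
    simp
  · rw [hb, pow_right_comm, g5_pow]
    simp

theorem exists_hasSign {ξ : ZOmega} (h : Int.gcd (N15 ξ) 15 = 1) : ∃ t, HasSign ξ t := by
  obtain ⟨a, ha⟩ := exists_r3_eq_pow (not_phi5_dvd h)
  obtain ⟨b, hb⟩ := exists_r5_eq_pow (not_phi3_dvd h)
  exact ⟨_, hasSign_of_eq_pow ha hb⟩

theorem HasSign.exists_eq_pow {ξ : ZOmega} {t : ℤˣ} (h : HasSign ξ t) :
    ∃ a b : ℕ, r3 ξ = (g3 : F81) ^ a ∧ r5 ξ = (g5 : F25) ^ b ∧ t = (-1) ^ (a + b) := by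
  have h' := h
  obtain ⟨s₃, s₅, -, h3, h5⟩ := h'
  have n3 : ¬ phi5 ∣ ξ := by
    rw [← r3_eq_zero_iff]
    intro h0
    rw [h0, zero_pow (by norm_num)] at h3
    exact (s₃.isUnit.map (Int.castRingHom F81)).ne_zero h3.symm
  have n5 : ¬ phi3 ∣ ξ := by
    rw [← r5_eq_zero_iff]
    intro h0
    rw [h0, zero_pow (by norm_num)] at h5
    exact (s₅.isUnit.map (Int.castRingHom F25)).ne_zero h5.symm
  obtain ⟨a, ha⟩ := exists_r3_eq_pow n3
  obtain ⟨b, hb⟩ := exists_r5_eq_pow n5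
  exact ⟨a, b, ha, hb, h.unique (hasSign_of_eq_pow ha hb)⟩

/-! ### The image of the units in the two residue groups -/

theorem r3_one_sub_omega_sq : Units.map r3.toMonoidHom (unitOneSub * unitOneAdd) = g3 ^ 27 := by
  apply Units.ext
  -- 27 ≡ 2 mod 5, so the cube of Frobenius carries 1 - ω to 1 - ω².
  have h : iterateFrobenius F81 3 3 (1 - r3 omega) = 1 - r3 omega ^ 2 := by
    rw [map_sub, map_one, iterateFrobenius_def]
    linear_combination (-r3 omega ^ 2 * (1 + r3 omega ^ 5 + r3 omega ^ 10 + r3 omega ^ 15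
      + r3 omega ^ 20)) * r3_omega_pow
  rw [iterateFrobenius_def] at h
  change r3 ((1 - omega) * (1 + omega)) = (r3 (1 - omega)) ^ 27
  rw [map_mul, map_sub, map_add, map_one]
  linear_combination -h

theorem r5_one_sub_omega_sq : Units.map r5.toMonoidHom (unitOneSub * unitOneAdd) = g5 ^ 5 := by
  apply Units.ext
  have h : iterateFrobenius F25 5 1 (1 - r5 omega) = 1 - r5 omega ^ 2 := by
    rw [map_sub, map_one, iterateFrobenius_def]
    linear_combination (-r5 omega ^ 2) * r5_omega_pow
  rw [iterateFrobenius_def] at h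
  change r5 ((1 - omega) * (1 + omega)) = (r5 (1 - omega)) ^ 5
  rw [map_mul, map_sub, map_add, map_one]
  linear_combination -h

theorem exists_unit_of_even {n l : ℤ} (h : Even (l - n)) :
    ∃ u : ZOmegaˣ, Units.map r3.toMonoidHom u = g3 ^ n ∧ Units.map r5.toMonoidHom u = g5 ^ l := by
  obtain ⟨m, hm⟩ := h
  have e3 : Units.map r3.toMonoidHom unitOneSub = g3 := rfl
  have e5 : Units.map r5.toMonoidHom unitOneSub = g5 := rfl
  -- The second factor has residues (1, g5^(5 - 27)) = (1, g5²) since g5 has order 24; it adjusts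
  -- the second exponent by any even amount.
  refine ⟨unitOneSub ^ n * (unitOneSub * unitOneAdd * unitOneSub ^ (-27 : ℤ)) ^ m, ?_, ?_⟩
  · rw [map_mul, map_zpow, map_zpow, map_mul, map_zpow, r3_one_sub_omega_sq, e3, zpow_neg]
    norm_cast
    simp
  · have h24 : g5 ^ (24 : ℤ) = 1 := by
      have := pow_orderOf_eq_one g5
      rw [orderOf_g5] at this
      exact_mod_cast this
    rw [map_mul, map_zpow, map_zpow, map_mul, map_zpow, r5_one_sub_omega_sq, e5]
    have : l = n + (5 - 27) * m + 24 * m := by linarith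
    rw [this, zpow_add, zpow_mul g5 24, h24, one_zpow, mul_one, zpow_add, zpow_mul,
      ← zpow_natCast g5 5, ← zpow_add]
    rfl

theorem HasSign.exists_unit_mul {ξ α : ZOmega} {t : ℤˣ} (h : HasSign ξ t) (h' : HasSign α t) :
    ∃ u : ZOmegaˣ, phi3 * phi5 ∣ ξ - u * α := by
  obtain ⟨a, b, ha, hb, ht⟩ := h.exists_eq_pow
  obtain ⟨a', b', ha', hb', ht'⟩ := h'.exists_eq_pow
  have hev : Even (((b : ℤ) - b') - ((a : ℤ) - a')) := by
    have h1 : (-1 : ℤˣ) ^ (a + b) = (-1) ^ (a' + b') := ht.symm.trans ht'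
    have h2 : (-1 : ℤ) ^ (a + b) = (-1) ^ (a' + b') := by
      simpa using congrArg Units.val h1
    have h3 : Even (a + b) ↔ Even (a' + b') := by
      rw [← neg_one_pow_eq_one_iff_even (R := ℤ) (by norm_num), h2,
        neg_one_pow_eq_one_iff_even (by norm_num)]
    simp only [Nat.even_iff, Int.even_iff] at h3 ⊢
    omega
  obtain ⟨u, hu3, hu5⟩ := exists_unit_of_even hev
  have hu3' : r3 u = ((g3 ^ ((a : ℤ) - a') : F81ˣ) : F81) := congrArg Units.val hu3
  have hu5' : r5 u = ((g5 ^ ((b : ℤ) - b') : F25ˣ) : F25) := congrArg Units.val hu5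
  refine ⟨u, isCoprime_phi3_phi5.mul_dvd ?_ ?_⟩
  · rw [← r5_eq_zero_iff, map_sub, map_mul, hu5', hb, hb', ← Units.val_pow_eq_pow_val,
      ← Units.val_pow_eq_pow_val, ← Units.val_mul, sub_eq_zero]
    congr 1
    rw [← zpow_natCast, ← zpow_natCast, ← zpow_add]
    congr 1
    ring
  · rw [← r3_eq_zero_iff, map_sub, map_mul, hu3', ha, ha', ← Units.val_pow_eq_pow_val,
      ← Units.val_pow_eq_pow_val, ← Units.val_mul, sub_eq_zero]
    congr 1
    rw [← zpow_natCast, ← zpow_natCast, ← zpow_add]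
    congr 1
    ring

/-! ### The signs of the two forms -/

theorem aeval_F1 (s : ℤˣ) (j : ℕ) (B g : ℤ[X]) : aeval omega (F1 s j B g) =
    (omega - 1) * phi5 + ((s : ℤ) : ZOmega) * omega ^ j * phi3 * aeval omega B
      + (omega - 1) * phi3 * phi5 * aeval omega g := by
  simp only [F1, map_add, map_mul, map_sub, map_pow, aeval_X, map_one, phi3_eq, phi5_eq,
    eq_intCast, map_intCast]
  rw [phi5]
  ring

theorem aeval_F2 (s : ℤˣ) (j : ℕ) (B g : ℤ[X]) : aeval omega (F2 s j B g) =
    (omega - 1) * phi3 + ((s : ℤ) : ZOmega) * omega ^ j * phi5 * aeval omega B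
      + (omega - 1) * phi3 * phi5 * aeval omega g := by
  simp only [F2, map_add, map_mul, map_sub, map_pow, aeval_X, map_one, phi3_eq, phi5_eq,
    eq_intCast, map_intCast]
  rw [phi3]
  ring

theorem units_cast_sq {A : Type*} [CommRing A] (s : ℤˣ) : ((s : ℤ) : A) ^ 2 = 1 := by
  obtain rfl | rfl := Int.units_eq_one_or s <;> simp

/-- Modulo 3, x² + x + 1 = (1 - x)²; hence `phi3` is a square here. -/
theorem r3_phi3 : r3 phi3 = (g3 : F81) ^ 2 := by
  rw [coe_g3, coe_unitOneSub, phi3]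
  simp only [map_add, map_pow, map_sub, map_one]
  linear_combination r3 omega * three_eq_zero

theorem r5_phi5 : r5 phi5 = -r5 omega ^ 2 := by
  rw [phi5]
  simp only [map_add, map_pow, map_one]
  linear_combination (r5 omega ^ 2 + 1) * r5_phi3

theorem r3_phi5_eq_zero : r3 phi5 = 0 := r3_eq_zero_iff.2 dvd_rfl

theorem r5_phi3_eq_zero : r5 phi3 = 0 := r5_eq_zero_iff.2 dvd_rfl

/-- At the prime above 3 only ±ωʲ `phi3` B survives, and all factors but B are squares. At the prime
above 5 what remains is (ω - 1) `phi5`, a nonsquare, whence the minus sign. -/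
theorem hasSign_F1 {s : ℤˣ} {j : ℕ} {B g : ℤ[X]} {b : ℤˣ}
    (hB : r3 (aeval omega B) ^ 40 = ((b : ℤ) : F81)) : HasSign (aeval omega (F1 s j B g)) (-b) := by
  refine ⟨b, -1, by simp, ?_, ?_⟩
  · have h : r3 (aeval omega (F1 s j B g)) =
        ((s : ℤ) : F81) * r3 omega ^ j * (g3 : F81) ^ 2 * r3 (aeval omega B) := by
      rw [aeval_F1]
      simp only [map_add, map_mul, map_pow, r3_phi5_eq_zero, r3_phi3, map_intCast]
      ring
    have hw : (r3 omega ^ j) ^ 40 = 1 := by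
      rw [pow_right_comm, pow_mul (r3 omega) 5 8, r3_omega_pow, one_pow, one_pow]
    have hs : (((s : ℤ) : F81)) ^ 40 = 1 := by
      rw [pow_mul _ 2 20, units_cast_sq, one_pow]
    have hg : ((g3 : F81) ^ 2) ^ 40 = 1 := by
      linear_combination ((g3 : F81) ^ 40 - 1) * g3_pow
    rw [h, mul_pow, mul_pow, mul_pow, hw, hs, hg, hB, one_mul, one_mul, one_mul]
  · have h : r5 (aeval omega (F1 s j B g)) = (g5 : F25) * r5 omega ^ 2 := by
      rw [aeval_F1, coe_g5, coe_unitOneSub]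
      simp only [map_add, map_mul, map_sub, map_one, map_pow, r5_phi3_eq_zero, r5_phi5, map_intCast]
      ring
    have hw : (r5 omega ^ 2) ^ 12 = 1 := by
      rw [pow_right_comm, pow_mul (r5 omega) 3 4, r5_omega_pow, one_pow, one_pow]
    rw [h, mul_pow, hw, g5_pow]
    simp

theorem hasSign_F2 {s : ℤˣ} {j : ℕ} {B g : ℤ[X]} {b : ℤˣ}
    (hB : r5 (aeval omega B) ^ 12 = ((b : ℤ) : F25)) : HasSign (aeval omega (F2 s j B g)) (-b) := by
  refine ⟨-1, b, by simp, ?_, ?_⟩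
  · have h : r3 (aeval omega (F2 s j B g)) = -(g3 : F81) ^ 3 := by
      rw [aeval_F2, pow_succ, ← r3_phi3, coe_g3, coe_unitOneSub]
      simp only [map_add, map_mul, map_sub, map_one, map_pow, r3_phi5_eq_zero, map_intCast]
      ring
    have hg : (-(g3 : F81) ^ 3) ^ 40 = -1 := by
      linear_combination (((g3 : F81) ^ 40) ^ 2 - (g3 : F81) ^ 40 + 1) * g3_pow
    rw [h, hg]
    simp
  · have h : r5 (aeval omega (F2 s j B g)) =
        ((s : ℤ) : F25) * r5 omega ^ j * (-r5 omega ^ 2) * r5 (aeval omega B) := by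
      rw [aeval_F2]
      simp only [map_add, map_mul, map_pow, r5_phi3_eq_zero, r5_phi5, map_intCast]
      ring
    have hw : (r5 omega ^ j) ^ 12 = 1 := by
      rw [pow_right_comm, pow_mul (r5 omega) 3 4, r5_omega_pow, one_pow, one_pow]
    have hs : (((s : ℤ) : F25)) ^ 12 = 1 := by
      rw [pow_mul _ 2 6, units_cast_sq, one_pow]
    have hw2 : (-r5 omega ^ 2) ^ 12 = 1 := by
      have : (-r5 omega ^ 2) ^ 12 = (r5 omega ^ 3) ^ 8 := by ring
      rw [this, r5_omega_pow, one_pow]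
    rw [h, mul_pow, mul_pow, mul_pow, hw, hs, hw2, hB, one_mul, one_mul, one_mul]

theorem exists_correction {ξ α : ZOmega} {u : ZOmegaˣ} (h : phi3 * phi5 ∣ ξ - u * α) :
    ∃ g : ℤ[X], ξ = u * (α + (omega - 1) * phi3 * phi5 * aeval omega g) := by
  obtain ⟨c, hc⟩ := h
  -- The unit factors u and ω - 1 = -(1 - ω) are divided out of the cofactor c.
  obtain ⟨g, hg⟩ := aeval_omega_surjective
    (-((unitOneSub⁻¹ : ZOmegaˣ) : ZOmega) * ((u⁻¹ : ZOmegaˣ) : ZOmega) * c)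
  refine ⟨g, ?_⟩
  rw [hg]
  have h1 : (1 - omega) * ((unitOneSub⁻¹ : ZOmegaˣ) : ZOmega) = 1 := unitOneSub.mul_inv
  have h2 : (u : ZOmega) * ((u⁻¹ : ZOmegaˣ) : ZOmega) = 1 := u.mul_inv
  linear_combination hc - phi3 * phi5 * c * (u : ZOmega) * ((u⁻¹ : ZOmegaˣ) : ZOmega) * h1
    - phi3 * phi5 * c * h2

theorem hasFirstForm_iff {B : ℤ[X]} {b : ℤˣ} (hB : r3 (aeval omega B) ^ 40 = ((b : ℤ) : F81))
    {ξ : ZOmega} : HasFirstForm B ξ ↔ HasSign ξ (-b) := by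
  constructor
  · rintro ⟨u, s, j, g, -, rfl⟩
    simpa using (units_hasSign u).mul (hasSign_F1 hB)
  · intro h
    obtain ⟨u, hu⟩ := h.exists_unit_mul (hasSign_F1 (s := 1) (j := 0) (g := 0) hB)
    obtain ⟨g, hg⟩ := exists_correction hu
    refine ⟨u, 1, 0, g, by norm_num, ?_⟩
    rw [aeval_F1, map_zero] at hg
    rw [aeval_F1, hg]
    ring

theorem hasSecondForm_iff {B : ℤ[X]} {b : ℤˣ} (hB : r5 (aeval omega B) ^ 12 = ((b : ℤ) : F25))
    {ξ : ZOmega} : HasSecondForm B ξ ↔ HasSign ξ (-b) := by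
  constructor
  · rintro ⟨u, s, j, g, -, rfl⟩
    simpa using (units_hasSign u).mul (hasSign_F2 hB)
  · intro h
    obtain ⟨u, hu⟩ := h.exists_unit_mul (hasSign_F2 (s := 1) (j := 0) (g := 0) hB)
    obtain ⟨g, hg⟩ := exists_correction hu
    refine ⟨u, 1, 0, g, by norm_num, ?_⟩
    rw [aeval_F2, map_zero] at hg
    rw [aeval_F2, hg]
    ring

theorem hasFirstForm_one_iff {ξ : ZOmega} : HasFirstForm 1 ξ ↔ HasSign ξ (-1) :=
  hasFirstForm_iff (by simp)

theorem hasSecondForm_one_iff {ξ : ZOmega} : HasSecondForm 1 ξ ↔ HasSign ξ (-1) :=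
  hasSecondForm_iff (by simp)

theorem hasFirstForm_X_sub_one_iff {ξ : ZOmega} : HasFirstForm (X - 1) ξ ↔ HasSign ξ 1 := by
  rw [hasFirstForm_iff (b := -1), neg_neg]
  have h : r3 (aeval omega (X - 1 : ℤ[X])) = -(g3 : F81) := by
    rw [coe_g3, coe_unitOneSub, ← map_neg]
    simp
  rw [h]
  push_cast
  linear_combination g3_pow

theorem hasSecondForm_X_sub_one_iff {ξ : ZOmega} : HasSecondForm (X - 1) ξ ↔ HasSign ξ 1 := by
  rw [hasSecondForm_iff (b := -1), neg_neg]
  have h : r5 (aeval omega (X - 1 : ℤ[X])) = -(g5 : F25) := by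
    rw [coe_g5, coe_unitOneSub, ← map_neg]
    simp
  rw [h]
  push_cast
  linear_combination g5_pow

theorem isGood_iff {ξ : ZOmega} : IsGood ξ ↔ HasSign ξ (-1) := by
  rw [IsGood, hasFirstForm_one_iff, hasSecondForm_one_iff, or_self]

theorem isBad_iff {ξ : ZOmega} : IsBad ξ ↔ HasSign ξ 1 := by
  rw [IsBad, hasFirstForm_X_sub_one_iff, hasSecondForm_X_sub_one_iff, or_self]

/-! ### Galois invariance of the sign -/

/-- In the residue field ω is a root of Φ₅ with ω⁵ = 1, and ωᵏ with 5 ∤ k is a root as well. So ω ↦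
ωᵏ preserves the ideal of `phi5`. -/
theorem phi5_dvd_aeval {k : ℕ} (hk : Nat.Coprime k 15) :
    phi5 ∣ aeval (omega ^ k) (cyclotomic 5 ℤ) := by
  have h5 : ¬ 5 ∣ k := fun h => by
    have := Nat.dvd_gcd h (by norm_num : 5 ∣ 15)
    rw [hk] at this
    norm_num at this
  have hw : r3 omega ^ k = r3 omega ^ (k % 5) := by
    conv_lhs => rw [← Nat.div_add_mod k 5, pow_add, pow_mul, r3_omega_pow, one_pow, one_mul]
  rw [← r3_eq_zero_iff, cyclotomic_five_int]
  simp only [map_add, map_pow, aeval_X, map_one]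
  rw [hw]
  have hlt := Nat.mod_lt k (by norm_num : 5 > 0)
  have hne : k % 5 ≠ 0 := fun h => h5 (Nat.dvd_of_mod_eq_zero h)
  generalize k % 5 = i at hlt hne
  have hφ := r3_phi5
  have h1 := r3_omega_pow
  generalize r3 omega = w at hφ h1
  interval_cases i
  · exact absurd rfl hne
  · linear_combination hφ
  · linear_combination hφ + (w ^ 3 + w) * h1
  · linear_combination hφ + (w + w ^ 4 + w ^ 2 * (w ^ 5 + 1)) * h1
  · linear_combination hφ + (w ^ 3 + w ^ 2 * (w ^ 5 + 1) + w * (w ^ 10 + w ^ 5 + 1)) * h1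

theorem phi3_dvd_aeval {k : ℕ} (hk : Nat.Coprime k 15) :
    phi3 ∣ aeval (omega ^ k) (cyclotomic 3 ℤ) := by
  have h3 : ¬ 3 ∣ k := fun h => by
    have := Nat.dvd_gcd h (by norm_num : 3 ∣ 15)
    rw [hk] at this
    norm_num at this
  have hw : r5 omega ^ k = r5 omega ^ (k % 3) := by
    conv_lhs => rw [← Nat.div_add_mod k 3, pow_add, pow_mul, r5_omega_pow, one_pow, one_mul]
  rw [← r5_eq_zero_iff, cyclotomic_three]
  simp only [map_add, map_pow, aeval_X, map_one]
  rw [hw]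
  have hlt := Nat.mod_lt k (by norm_num : 3 > 0)
  have hne : k % 3 ≠ 0 := fun h => h3 (Nat.dvd_of_mod_eq_zero h)
  generalize k % 3 = i at hlt hne
  have hφ := r5_phi3
  have h1 := r5_omega_pow
  generalize r5 omega = w at hφ h1
  interval_cases i
  · exact absurd rfl hne
  · linear_combination hφ
  · linear_combination hφ + w * h1

theorem HasSign.conjugate {F : ℤ[X]} {t : ℤˣ} (h : HasSign (aeval omega F) t) {k : ℕ}
    (hk : Nat.Coprime k 15) : HasSign (aeval (omega ^ k) F) t := by
  let σ : ZOmega →+* ZOmega := lift (omega ^ k) (aeval_cyclotomic_of_isPrimitiveRoot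
    (omega_isPrimitiveRoot.pow_of_coprime k hk))
  have hσ : ∀ G : ℤ[X], σ (aeval omega G) = aeval (omega ^ k) G := lift_aeval _ _
  obtain ⟨s₃, s₅, ht, h3, h5⟩ := h
  refine ⟨s₃, s₅, ht, ?_, ?_⟩
  -- The character value is a divisibility of ξ⁴⁰ - s₃ by `phi5`, to which the automorphism can be
  -- applied.
  · rw [← map_pow, ← map_intCast r3, ← sub_eq_zero, ← map_sub, r3_eq_zero_iff] at h3 ⊢
    have := map_dvd σ h3
    rw [map_sub, map_pow, hσ, map_intCast, ← phi5_eq, hσ] at this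
    exact (phi5_dvd_aeval hk).trans this
  · rw [← map_pow, ← map_intCast r5, ← sub_eq_zero, ← map_sub, r5_eq_zero_iff] at h5 ⊢
    have := map_dvd σ h5
    rw [map_sub, map_pow, hσ, map_intCast, ← phi3_eq, hσ] at this
    exact (phi3_dvd_aeval hk).trans this

end GoodBad

theorem mainTheorem5 :
    -- every `ξ` of norm prime to 15 has both forms, with one and the same `B ∈ {1, x - 1}`
    (∀ ξ : GoodBad.ZOmega, Int.gcd (GoodBad.N15 ξ) 15 = 1 →
      ∃ B : Polynomial ℤ, (B = 1 ∨ B = Polynomial.X - 1) ∧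
        GoodBad.HasFirstForm B ξ ∧ GoodBad.HasSecondForm B ξ) ∧
    -- no `ξ` is both good and bad, and `1` is bad
    (∀ ξ : GoodBad.ZOmega, Int.gcd (GoodBad.N15 ξ) 15 = 1 →
      ¬ (GoodBad.IsGood ξ ∧ GoodBad.IsBad ξ)) ∧
    GoodBad.IsBad 1 ∧
    -- products
    (∀ ξ₁ ξ₂ : GoodBad.ZOmega,
      Int.gcd (GoodBad.N15 ξ₁) 15 = 1 → Int.gcd (GoodBad.N15 ξ₂) 15 = 1 →
        (GoodBad.IsGood ξ₁ → GoodBad.IsGood ξ₂ → GoodBad.IsBad (ξ₁ * ξ₂)) ∧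
        (GoodBad.IsBad ξ₁ → GoodBad.IsBad ξ₂ → GoodBad.IsBad (ξ₁ * ξ₂)) ∧
        (GoodBad.IsGood ξ₁ → GoodBad.IsBad ξ₂ → GoodBad.IsGood (ξ₁ * ξ₂)) ∧
        (GoodBad.IsBad ξ₁ → GoodBad.IsGood ξ₂ → GoodBad.IsGood (ξ₁ * ξ₂))) ∧
    -- the conjugates `F(ω^k)`, `gcd(k, 15) = 1`, of `ξ = F(ω)` are all good or all bad
    (∀ F : Polynomial ℤ,
      Int.gcd (GoodBad.N15 (Polynomial.aeval GoodBad.omega F)) 15 = 1 →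
        (∀ k : ℕ, Nat.Coprime k 15 →
          GoodBad.IsGood (Polynomial.aeval (GoodBad.omega ^ k) F)) ∨
        (∀ k : ℕ, Nat.Coprime k 15 →
          GoodBad.IsBad (Polynomial.aeval (GoodBad.omega ^ k) F))) := by

  open GoodBad in
  simp only [isGood_iff, isBad_iff]
  refine ⟨fun ξ hξ => ?_, fun ξ _ h => ?_, ?_, fun ξ₁ ξ₂ _ _ => ?_, fun F hF => ?_⟩
  · obtain ⟨t, ht⟩ := exists_hasSign hξ
    obtain rfl | rfl := Int.units_eq_one_or t
    · exact ⟨X - 1, Or.inr rfl, hasFirstForm_X_sub_one_iff.2 ht,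
        hasSecondForm_X_sub_one_iff.2 ht⟩
    · exact ⟨1, Or.inl rfl, hasFirstForm_one_iff.2 ht, hasSecondForm_one_iff.2 ht⟩
  · exact absurd (h.1.unique h.2) (by decide)
  · exact units_hasSign 1
  · exact ⟨fun h₁ h₂ => by simpa using h₁.mul h₂, fun h₁ h₂ => by simpa using h₁.mul h₂,
      fun h₁ h₂ => by simpa using h₁.mul h₂, fun h₁ h₂ => by simpa using h₁.mul h₂⟩
  · obtain ⟨t, ht⟩ := exists_hasSign hF
    obtain rfl | rfl := Int.units_eq_one_or t
    · exact Or.inr fun k hk => ht.conjugate hk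
    · exact Or.inl fun k hk => ht.conjugate hk
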